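/- Let $n\ge 1$ and let $T\colon M_n(\mathbb{C})\to M_n(\mathbb{C})$ be a $\mathbb{C}$-linear map with $T(1)=1$ which is a spectral isometry, i.e. $r(Tx)=r(x)$ for every $x\in M_n(\mathbb{C})$, where $r(x)=\max\{|\lambda| : \lambda\in\sigma(x)\}$ denotes the spectral radius. Then $T$ is a Jordan automorphism of $M_n(\mathbb{C})$: $T$ is bijective and $T(x\circ y)=(Tx)\circ(Ty)$ for all $x,y\in M_n(\mathbb{C})$, where $x\circ y=\tfrac12(xy+yx)$. -/

import Mathlib

/-- A linear map `T : A → B` between unital complex algebras is a spectral isometry if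
`r(T x) = r(x)` for all `x`, where `r` is the spectral radius. -/
def IsSpectralIsometry {A B : Type*} [Ring A] [Algebra ℂ A] [Ring B] [Algebra ℂ B]
    (T : A →ₗ[ℂ] B) : Prop :=
  ∀ x : A, spectralRadius ℂ (T x) = spectralRadius ℂ x

/-- The Jordan product `x ∘ y = (xy + yx) / 2`. -/
noncomputable def jordanProduct {A : Type*} [Ring A] [Algebra ℂ A] (x y : A) : A :=
  (1 / 2 : ℂ) • (x * y + y * x)

/-- A Jordan automorphism of `A`: a bijective linear map of `A` onto itself that preserves the
Jordan product. -/
structure IsJordanAutomorphism {A : Type*} [Ring A] [Algebra ℂ A] (T : A →ₗ[ℂ] A) : Prop where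
  bijective : Function.Bijective T
  map_jordanProduct : ∀ x y : A, T (jordanProduct x y) = jordanProduct (T x) (T y)

/-! A unital spectral isometry keeps peripheral eigenvalues (`mem_spectrum_of_unimodular`). If all
eigenvalues of `A` are distinct and unimodular, `T A` therefore has the same spectrum, so `tr (T
A)^k = tr A^k`. Both sides are polynomial in the coefficients of `A`, which extends this to
Hermitian and then to all matrices. Polarising `k = 2` shows that `T` preserves the nondegenerate
trace form, hence is bijective; polarising `k = 3` then gives `T (A²) = (T A)²`. -/

/-- The trace of a power of a linear combination of matrices is polynomial in the coefficients, so
an identity between two such traces extends from a product of infinite sets. -/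
theorem trace_pow_sum_smul_eq_of_infinite {m R ι : Type*} [Fintype m] [DecidableEq m]
    [CommRing R] [IsDomain R] [Fintype ι] (s : ι → Set R) (hs : ∀ i, (s i).Infinite)
    (A B : ι → Matrix m m R) (k : ℕ)
    (h : ∀ z ∈ Set.pi .univ s,
      ((∑ i, z i • A i) ^ k).trace = ((∑ i, z i • B i) ^ k).trace) (z : ι → R) :
    ((∑ i, z i • A i) ^ k).trace = ((∑ i, z i • B i) ^ k).trace := by
  classical
  let p (C : ι → Matrix m m R) : MvPolynomial ι R :=
    ((∑ i, (MvPolynomial.X i : MvPolynomial ι R) • (C i).map MvPolynomial.C) ^ k).trace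
  have hp (C : ι → Matrix m m R) (w : ι → R) :
      MvPolynomial.eval w (p C) = ((∑ i, w i • C i) ^ k).trace := by
    simp only [p]
    rw [AddMonoidHom.map_trace (MvPolynomial.eval w), Matrix.map_pow]
    congr 2
    ext a b
    simp [Matrix.sum_apply]
  have := MvPolynomial.funext_set s hs (p := p A) (q := p B)
    fun w hw => by rw [hp, hp, h w hw]
  rw [← hp, ← hp, this]

/-- A matrix with as many distinct eigenvalues as its size is diagonalizable; hence the traces of
its powers are the power sums of these eigenvalues. -/
theorem Matrix.trace_pow_eq_sum_of_injective {m K : Type*} [Fintype m] [DecidableEq m] [Field K]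
    (A : Matrix m m K) (z : m → K) (hz : Function.Injective z)
    (h : ∀ i, z i ∈ spectrum K A) (k : ℕ) : (A ^ k).trace = ∑ i, z i ^ k := by
  have hv (i : m) : ∃ v : m → K, Module.End.HasEigenvector (Matrix.toLin' A) (z i) v := by
    have hi := h i
    rw [← Matrix.spectrum_toLin', ← Module.End.hasEigenvalue_iff_mem_spectrum] at hi
    exact hi.exists_hasEigenvector
  choose v hv using hv
  have hli : LinearIndependent K v :=
    Module.End.eigenvectors_linearIndependent' (Matrix.toLin' A) z hz v hv
  let P : Matrix m m K := (Matrix.of v).transpose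
  have hP : IsUnit P := Matrix.linearIndependent_cols_iff_isUnit.mp hli
  have hAP : A * P = P * Matrix.diagonal z := by
    ext i j
    have := congrFun (hv j).apply_eq_smul i
    rw [Matrix.mul_diagonal, mul_comm]
    simpa [P, Matrix.mul_apply, Matrix.mulVec, dotProduct] using this
  have hAkP : A ^ k * P = P * Matrix.diagonal z ^ k :=
    ((show SemiconjBy P (Matrix.diagonal z) A from hAP.symm).pow_right k).symm
  obtain ⟨u, hu⟩ := hP
  have : A ^ k = P * Matrix.diagonal z ^ k * (↑u⁻¹ : Matrix m m K) := by
    rw [← hAkP, ← hu, mul_assoc, u.mul_inv, mul_one]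
  rw [this, Matrix.trace_mul_comm, ← hu, ← mul_assoc, u.inv_mul, one_mul, Matrix.diagonal_pow,
    Matrix.trace_diagonal]
  rfl

theorem spectrum_add_smul_one_iff {A : Type*} [Ring A] [Algebra ℂ A] (a : A) (c k : ℂ) :
    k ∈ spectrum ℂ (a + c • 1) ↔ k - c ∈ spectrum ℂ a := by
  rw [← Algebra.algebraMap_eq_smul_one, add_comm, ← spectrum.singleton_add_eq]
  simp [Set.singleton_add, sub_eq_neg_add]

/-- In finite dimension the spectral radius is attained. -/
theorem Matrix.exists_mem_spectrum_nnnorm_eq {m : Type*} [Fintype m] [DecidableEq m] [Nonempty m]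
    (A : Matrix m m ℂ) : ∃ k ∈ spectrum ℂ A, (‖k‖₊ : ENNReal) = spectralRadius ℂ A := by
  have hfin : (spectrum ℂ A).Finite := Matrix.finite_spectrum A
  have hne : (spectrum ℂ A).Nonempty := spectrum.nonempty_of_isAlgClosed_of_finiteDimensional ℂ A
  obtain ⟨k, hk, hmax⟩ := Set.exists_max_image _ (fun k : ℂ => ‖k‖₊) hfin hne
  refine ⟨k, hk, le_antisymm (le_iSup₂ (f := fun k _ => (‖k‖₊ : ENNReal)) k hk)
    (iSup₂_le fun j hj => ?_)⟩
  exact_mod_cast hmax j hj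

/-- Translating by `z` creates the eigenvalue `2z`, so some `w` in the spectrum of `T A`, where `‖w‖
≤ 1`, has `‖w + z‖ ≥ 2`. Strict convexity of the disc forces `w = z`. -/
theorem IsSpectralIsometry.mem_spectrum_of_unimodular {m : Type*} [Fintype m] [DecidableEq m]
    {T : Matrix m m ℂ →ₗ[ℂ] Matrix m m ℂ} (hT : IsSpectralIsometry T) (hone : T 1 = 1)
    (A : Matrix m m ℂ) (hA : ∀ k ∈ spectrum ℂ A, ‖k‖ ≤ 1) (z : ℂ) (hz : z ∈ spectrum ℂ A)
    (hz1 : ‖z‖ = 1) : z ∈ spectrum ℂ (T A) := by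
  have : Nonempty m := by
    by_contra hm
    rw [not_nonempty_iff] at hm
    exact hz (isUnit_of_subsingleton _)
  have hTA : ∀ k ∈ spectrum ℂ (T A), ‖k‖ ≤ 1 := by
    intro k hk
    have h1 : (‖k‖₊ : ENNReal) ≤ spectralRadius ℂ (T A) :=
      le_iSup₂ (f := fun k _ => (‖k‖₊ : ENNReal)) k hk
    rw [hT A] at h1
    have h2 : spectralRadius ℂ A ≤ 1 := iSup₂_le fun j hj => by exact_mod_cast hA j hj
    exact_mod_cast h1.trans h2
  obtain ⟨k, hk, hkr⟩ := (T (A + z • 1)).exists_mem_spectrum_nnnorm_eq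
  rw [hT] at hkr
  rw [map_add, map_smul, hone, spectrum_add_smul_one_iff] at hk
  have hmem : z + z ∈ spectrum ℂ (A + z • (1 : Matrix m m ℂ)) := by
    rw [spectrum_add_smul_one_iff]; simpa using hz
  have hle : (‖z + z‖₊ : ENNReal) ≤ ‖k‖₊ :=
    hkr ▸ le_iSup₂ (f := fun k _ => (‖k‖₊ : ENNReal)) _ hmem
  have hle' : ‖z + z‖ ≤ ‖k‖ := by exact_mod_cast hle
  have hzz : ‖z + z‖ = 2 := by rw [← two_mul, norm_mul, hz1]; norm_num
  have hw : ‖k - z‖ ≤ 1 := hTA _ hk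
  have hk2 : ‖k‖ ≤ ‖k - z‖ + ‖z‖ := norm_le_norm_sub_add k z
  have hw1 : ‖k - z‖ = ‖z‖ := by linarith
  have : k - z = z := eq_of_norm_eq_of_norm_add_eq hw1 (by rw [sub_add_cancel]; linarith)
  rwa [this] at hk

/-- Provides a grid large enough for polynomial identities, on which all eigenvalues are simple and
peripheral. -/
theorem exists_disjoint_infinite_unimodular (ι : Type*) [Countable ι] :
    ∃ s : ι → Set ℂ, (∀ i, (s i).Infinite) ∧ (∀ i, ∀ z ∈ s i, ‖z‖ = 1) ∧
      ∀ z ∈ Set.pi .univ s, Function.Injective z := by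
  have hinf : Infinite Circle := (Circle.argEquiv.infinite_iff).mpr
    (Set.Ioc_infinite (by linarith [Real.pi_pos])).to_subtype
  obtain ⟨f, hf⟩ := exists_injective_nat (ι × ℕ)
  let g : ι × ℕ → ℂ := fun p => (Infinite.natEmbedding Circle (f p) : ℂ)
  have hg : Function.Injective g :=
    Circle.coe_injective.comp ((Infinite.natEmbedding Circle).injective.comp hf)
  refine ⟨fun i => Set.range fun m => g (i, m), fun i => ?_, ?_, ?_⟩
  · exact Set.infinite_range_of_injective fun a b h => (Prod.ext_iff.mp (hg h)).2
  · rintro i _ ⟨m, rfl⟩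
    exact Circle.norm_coe _
  · intro z hz i j hij
    obtain ⟨a, ha⟩ := hz i trivial
    obtain ⟨b, hb⟩ := hz j trivial
    exact (Prod.ext_iff.mp (hg (ha.trans (hij.trans hb.symm)))).1

namespace IsSpectralIsometry

variable {m : Type*} [Fintype m] [DecidableEq m] {T : Matrix m m ℂ →ₗ[ℂ] Matrix m m ℂ}

theorem trace_pow_map_conj_diagonal (hT : IsSpectralIsometry T) (hone : T 1 = 1)
    (u : (Matrix m m ℂ)ˣ) (z : m → ℂ) (k : ℕ) :
    (T (u * Matrix.diagonal z * (↑u⁻¹ : Matrix m m ℂ)) ^ k).trace =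
      ((u * Matrix.diagonal z * (↑u⁻¹ : Matrix m m ℂ)) ^ k).trace := by
  let B (i : m) : Matrix m m ℂ := (u : Matrix m m ℂ) * Matrix.single i i (1 : ℂ) * (↑u⁻¹ : Matrix m m ℂ)
  have hB (w : m → ℂ) : u * Matrix.diagonal w * (↑u⁻¹ : Matrix m m ℂ) = ∑ i, w i • B i := by
    have : Matrix.diagonal w = ∑ i, w i • Matrix.single i i (1 : ℂ) := by
      simp [Matrix.smul_single, Matrix.sum_single_eq_diagonal]
    simp only [B, this, Finset.mul_sum, Finset.sum_mul, mul_smul_comm, smul_mul_assoc]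
  obtain ⟨s, hs, hs1, hsi⟩ := exists_disjoint_infinite_unimodular m
  have key := trace_pow_sum_smul_eq_of_infinite s hs (fun i => T (B i)) B k ?_ z
  · rw [hB, ← key]; simp
  · intro w hw
    have hT' : ∑ i, w i • T (B i) = T (∑ i, w i • B i) := by simp
    rw [hT', ← hB]
    have hspec : spectrum ℂ (u * Matrix.diagonal w * (↑u⁻¹ : Matrix m m ℂ)) = Set.range w := by
      rw [spectrum.units_conjugate, spectrum_diagonal]
    have hmem (i : m) : w i ∈ spectrum ℂ (u * Matrix.diagonal w * (↑u⁻¹ : Matrix m m ℂ)) := by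
      rw [hspec]; exact ⟨i, rfl⟩
    rw [Matrix.trace_pow_eq_sum_of_injective _ w (hsi w hw) hmem,
      Matrix.trace_pow_eq_sum_of_injective _ w (hsi w hw)]
    refine fun i => hT.mem_spectrum_of_unimodular hone _ ?_ _ (hmem i) (hs1 i _ (hw i trivial))
    rw [hspec]
    rintro _ ⟨j, rfl⟩
    exact (hs1 j _ (hw j trivial)).le

theorem trace_pow_map_of_isHermitian (hT : IsSpectralIsometry T) (hone : T 1 = 1)
    {A : Matrix m m ℂ} (hA : A.IsHermitian) (k : ℕ) : (T A ^ k).trace = (A ^ k).trace := by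
  have := hT.trace_pow_map_conj_diagonal hone (Unitary.toUnits hA.eigenvectorUnitary)
    (RCLike.ofReal ∘ hA.eigenvalues) k
  have h2 := hA.spectral_theorem
  rw [Unitary.conjStarAlgAut_apply] at h2
  have h3 : ((Unitary.toUnits hA.eigenvectorUnitary : (Matrix m m ℂ)ˣ) : Matrix m m ℂ) *
      Matrix.diagonal (RCLike.ofReal ∘ hA.eigenvalues) *
      (↑(Unitary.toUnits hA.eigenvectorUnitary)⁻¹ : Matrix m m ℂ) = A := h2.symm
  rwa [h3] at this

/-- A unital spectral isometry of a matrix algebra preserves all power traces. -/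
theorem trace_pow_map (hT : IsSpectralIsometry T) (hone : T 1 = 1) (A : Matrix m m ℂ) (k : ℕ) :
    (T A ^ k).trace = (A ^ k).trace := by
  let B : Fin 2 → Matrix m m ℂ := ![(realPart A : Matrix m m ℂ), (imaginaryPart A : Matrix m m ℂ)]
  have hBh (i : Fin 2) : (B i).IsHermitian := by
    fin_cases i
    · exact (realPart A).2
    · exact (imaginaryPart A).2
  have hA : A = ∑ i, (![1, Complex.I] : Fin 2 → ℂ) i • B i := by
    simpa [Fin.sum_univ_two, B] using (realPart_add_I_smul_imaginaryPart A).symm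
  -- Real combinations of the real and imaginary parts are Hermitian; the polynomial identity
  -- extends to the coefficients `(1, i)`.
  have key := trace_pow_sum_smul_eq_of_infinite (fun _ : Fin 2 => Set.range ((↑) : ℝ → ℂ))
    (fun _ => Set.infinite_range_of_injective Complex.ofReal_injective) (fun i => T (B i)) B k ?_
    ![1, Complex.I]
  · rw [← hA] at key
    rw [← key]
    conv_lhs => rw [hA]
    simp only [map_sum, map_smul]
  · intro w hw
    have hT' : ∑ i, w i • T (B i) = T (∑ i, w i • B i) := by simp
    rw [hT']
    refine hT.trace_pow_map_of_isHermitian hone ?_ k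
    rw [Matrix.IsHermitian, Matrix.conjTranspose_sum]
    refine Finset.sum_congr rfl fun i _ => ?_
    obtain ⟨r, hr⟩ := hw i trivial
    rw [Matrix.conjTranspose_smul, (hBh i).eq, ← hr]
    simp

theorem trace_mul_map (hT : IsSpectralIsometry T) (hone : T 1 = 1) (A B : Matrix m m ℂ) :
    (T A * T B).trace = (A * B).trace := by
  have h := hT.trace_pow_map hone (A + B) 2
  have hA := hT.trace_pow_map hone A 2
  have hB := hT.trace_pow_map hone B 2
  simp only [map_add, pow_two, mul_add, add_mul, Matrix.trace_add] at h hA hB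
  rw [Matrix.trace_mul_comm (T B), Matrix.trace_mul_comm B] at h
  linear_combination (h - hA - hB) / 2

theorem trace_mul_mul_self_map (hT : IsSpectralIsometry T) (hone : T 1 = 1)
    (A B : Matrix m m ℂ) : (T A * (T B * T B)).trace = (A * (B * B)).trace := by
  have polar (X Y : Matrix m m ℂ) : ((X + Y) ^ 3).trace + ((X - Y) ^ 3).trace =
      2 * (X ^ 3).trace + 6 * (X * (Y * Y)).trace := by
    -- Terms odd in `Y` cancel; cyclicity of the trace merges the other mixed ones.
    have e : (X + Y) ^ 3 + (X - Y) ^ 3 =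
        X ^ 3 + X ^ 3 + (X * (Y * Y) + X * (Y * Y) + (Y * X * Y + Y * X * Y) +
          (Y * Y * X + Y * Y * X)) := by
      noncomm_ring
    rw [← Matrix.trace_add, e]
    simp only [Matrix.trace_add]
    rw [Matrix.trace_mul_comm (Y * Y) X, Matrix.trace_mul_cycle Y X Y,
      Matrix.trace_mul_comm (Y * Y) X]
    ring
  have h1 := hT.trace_pow_map hone (A + B) 3
  have h2 := hT.trace_pow_map hone (A - B) 3
  have h3 := hT.trace_pow_map hone A 3
  rw [map_add] at h1
  rw [map_sub] at h2
  linear_combination (h1 + h2 - 2 * h3 - polar (T A) (T B) + polar A B) / 6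

theorem bijective (hT : IsSpectralIsometry T) (hone : T 1 = 1) : Function.Bijective T := by
  have hinj : Function.Injective T := by
    rw [injective_iff_map_eq_zero]
    intro A hA
    refine Matrix.ext_iff_trace_mul_right.mpr fun B => ?_
    rw [← hT.trace_mul_map hone, hA]
    simp
  exact ⟨hinj, LinearMap.injective_iff_surjective.mp hinj⟩

theorem map_mul_self (hT : IsSpectralIsometry T) (hone : T 1 = 1) (A : Matrix m m ℂ) :
    T (A * A) = T A * T A := by
  refine Matrix.ext_iff_trace_mul_left.mpr fun X => ?_
  -- Testing against `T Y` reduces both sides to `tr (Y A²)`.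
  obtain ⟨Y, rfl⟩ := (hT.bijective hone).2 X
  rw [hT.trace_mul_map hone, hT.trace_mul_mul_self_map hone]

end IsSpectralIsometry

theorem mainTheorem9 (n : ℕ)
    (T : Matrix (Fin n) (Fin n) ℂ →ₗ[ℂ] Matrix (Fin n) (Fin n) ℂ)
    (hunital : T 1 = 1) (hT : IsSpectralIsometry T) :
    IsJordanAutomorphism T := by
  refine ⟨hT.bijective hunital, fun x y => ?_⟩
  have h := hT.map_mul_self hunital (x + y)
  simp only [mul_add, add_mul, map_add, hT.map_mul_self hunital x,
    hT.map_mul_self hunital y] at h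
  rw [jordanProduct, jordanProduct, map_smul, map_add]
  congr 1
  rw [← sub_eq_zero] at h ⊢
  rw [← h]
  abel
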